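/- Let $n\ge 1$, let $k=p\,2^{q}$ with $p$ a positive odd integer and $q\ge 1$ an integer, and let $G$ be a complete balanced $k$-partite graph with $n$ vertices in each part; that is, $G$ is a finite simple graph whose vertex set can be partitioned into $k$ sets $V_1,\dots,V_k$ with $|V_1|=\dots=|V_k|=n$ such that two vertices are adjacent if and only if they belong to different sets $V_i$. Then for every integer $t$ with $$(k-1)n\le t\le (2k-p-q)n-1,$$ $G$ has an interval $t$-coloring, i.e. a map $\alpha$ from the edges of $G$ onto $\{1,\dots,t\}$ such that for every vertex $v$ the colors of the edges incident to $v$ are pairwise distinct and form an interval of consecutive integers. -/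

import Mathlib

namespace SimpleGraph

/-- `G` is a complete balanced `k`-partite graph with `n` vertices in each part: its vertices can
be partitioned into `k` classes `V₁, …, V_k` (the fibres of `part`), each with `n` vertices, such
that two vertices are adjacent if and only if they lie in different classes. -/
def IsCompleteBalancedMultipartite {V : Type*} (G : SimpleGraph V) (k n : ℕ) : Prop :=
  ∃ part : V → Fin k,
    (∀ i : Fin k, {v : V | part v = i}.ncard = n) ∧
    ∀ u v : V, G.Adj u v ↔ part u ≠ part v

/-- The set `S(v, α)` of colors appearing on the edges of `G` incident to the vertex `v`. -/
def colorsAt {V : Type*} (G : SimpleGraph V) (α : G.edgeSet → ℕ) (v : V) : Set ℕ :=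
  {c : ℕ | ∃ e : G.edgeSet, v ∈ (e : Sym2 V) ∧ α e = c}

/-- `α` is an interval `t`-coloring of the edges of `G`. -/
structure IsIntervalColoring {V : Type*} (G : SimpleGraph V) (t : ℕ) (α : G.edgeSet → ℕ) :
    Prop where
  /-- The colors are `1, …, t`, and all of them are used. -/
  range_eq : Set.range α = Set.Icc 1 t
  /-- The colors of the edges incident to each vertex are distinct. -/
  proper : ∀ (v : V) (e e' : G.edgeSet), v ∈ (e : Sym2 V) → v ∈ (e' : Sym2 V) →
    e ≠ e' → α e ≠ α e'
  /-- The colors of the edges incident to each vertex form an interval of integers. -/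
  interval : ∀ v : V, ∃ a b : ℕ, G.colorsAt α v = Set.Icc a b

end SimpleGraph

namespace SimpleGraph

/-- A symmetric labelling `c` of the pairs of vertices such that the edges of `G` at each vertex `v`
get distinct labels in the window `[a v, a v + d)`, the windows being contained in `[0, t)` and
covering it. -/
structure IsWindowLabelling {V : Type*} (G : SimpleGraph V) (d t : ℕ) (c : V → V → ℕ) (a : V → ℕ) :
    Prop where
  symm : ∀ v w, c v w = c w v
  lower : ∀ v w, G.Adj v w → a v ≤ c v w
  upper : ∀ v w, G.Adj v w → c v w < a v + d
  inj : ∀ v w w', G.Adj v w → G.Adj v w' → c v w = c v w' → w = w'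
  le : ∀ v, a v + d ≤ t
  cover : ∀ x < t, ∃ v, a v ≤ x ∧ x < a v + d

namespace IsWindowLabelling

/-- Relabelling the top label `t` by `t - d` lowers the number of labels by one. -/
theorem descend {V : Type*} {G : SimpleGraph V} {d t : ℕ} {c : V → V → ℕ} {a : V → ℕ}
    (h : G.IsWindowLabelling d (t + 1) c a) (hd : d ≤ t) :
    G.IsWindowLabelling d t (fun v w => if c v w = t then t - d else c v w)
      (fun v => if a v + d = t + 1 then t - d else a v) where
  -- A window containing `t` must end there, so it is `[t + 1 - d, t]` and misses `t - d`. Folding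
  -- moves it to `[t - d, t - 1]` without collision, and both ends of an edge labelled `t` have this
  -- window.
  symm v w := by simp only [h.symm v w]
  lower v w e := by
    have := h.lower v w e
    have := h.upper v w e
    have := h.le v
    split_ifs <;> omega
  upper v w e := by
    have := h.lower v w e
    have := h.upper v w e
    have := h.le v
    split_ifs <;> omega
  inj v w w' e e' hc := by
    have := h.lower v w e
    have := h.upper v w e
    have := h.lower v w' e'
    have := h.upper v w' e'
    have := h.le v
    refine h.inj v w w' e e' ?_
    split_ifs at hc <;> omega
  le v := by
    have := h.le v
    split_ifs <;> omega
  cover x hx := by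
    obtain ⟨v, h1, h2⟩ := h.cover x (by omega)
    refine ⟨v, ?_⟩
    split_ifs <;> omega

theorem exists_of_le {V : Type*} {G : SimpleGraph V} {d s t : ℕ} {c : V → V → ℕ} {a : V → ℕ}
    (h : G.IsWindowLabelling d t c a) (hd : d ≤ s) (hs : s ≤ t) :
    ∃ c a, G.IsWindowLabelling d s c a := by
  induction t, hs using Nat.le_induction generalizing c a with
  | base => exact ⟨c, a, h⟩
  | succ t hst ih => exact ih (h.descend (hd.trans hst))

theorem of_iso {V W : Type*} {G : SimpleGraph V} {H : SimpleGraph W} {d t : ℕ} {c : W → W → ℕ}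
    {a : W → ℕ} (h : H.IsWindowLabelling d t c a) (f : G ≃g H) :
    G.IsWindowLabelling d t (fun v w => c (f v) (f w)) (fun v => a (f v)) where
  symm v w := h.symm _ _
  lower v w e := h.lower _ _ (f.map_adj_iff.2 e)
  upper v w e := h.upper _ _ (f.map_adj_iff.2 e)
  inj v w w' e e' hc :=
    f.injective (h.inj _ _ _ (f.map_adj_iff.2 e) (f.map_adj_iff.2 e') hc)
  le v := h.le _
  cover x hx := by
    obtain ⟨w, hw⟩ := h.cover x hx
    exact ⟨f.symm w, by simpa using hw⟩

/-- The complete graph on `2 m` vertices has a labelling with `3 m - 2` labels. -/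
theorem exists_top_bool_prod_fin (m : ℕ) (hm : 1 ≤ m) :
    ∃ c a, (⊤ : SimpleGraph (Bool × Fin m)).IsWindowLabelling (2 * m - 1) (3 * m - 2) c a := by
  -- At `(b, i)`, the edges to `(b, j)` with `j ≠ i` and to `(!b, i)` take the labels `i, …, m - 1`
  -- and `2m - 1, …, 2m - 2 + i`, the two ends of the window. The edge from `(false, i)` to `(true,
  -- j)`, `i ≠ j`, gets `m - 1 + ((j - i) mod m)`; these fill the gap `m, …, 2m - 2`.
  refine ⟨fun u v =>
    if u.1 = v.1 ∨ u.2 = v.2 then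
      if u.2.1 + v.2.1 < m then u.2.1 + v.2.1 else u.2.1 + v.2.1 + m - 1
    else if (u.1 = false ↔ u.2.1 < v.2.1) then m - 1 + (max u.2.1 v.2.1 - min u.2.1 v.2.1)
    else 2 * m - 1 - (max u.2.1 v.2.1 - min u.2.1 v.2.1), fun u => u.2.1, ?_, ?_, ?_, ?_, ?_, ?_⟩
  · rintro ⟨b, i, hi⟩ ⟨b', j, hj⟩
    cases b <;> cases b' <;> simp [Fin.ext_iff] <;> grind
  · rintro ⟨b, i, hi⟩ ⟨b', j, hj⟩ e
    cases b <;> cases b' <;> simp [Fin.ext_iff] at e ⊢ <;> grind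
  · rintro ⟨b, i, hi⟩ ⟨b', j, hj⟩ e
    cases b <;> cases b' <;> simp [Fin.ext_iff] at e ⊢ <;> grind
  · rintro ⟨b, i, hi⟩ ⟨b', j, hj⟩ ⟨b'', l, hl⟩ e e' h
    cases b <;> cases b' <;> cases b'' <;> simp [Fin.ext_iff] at e e' h ⊢ <;> grind
  · rintro ⟨b, i, hi⟩
    dsimp only
    omega
  · intro x hx
    refine ⟨(false, ⟨min x (m - 1), by omega⟩), ?_, ?_⟩ <;> dsimp only <;> omega

/-- A labelling of a complete graph yields one of the complete graph with twice as many vertices. -/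
theorem double {U : Type*} {d t : ℕ} {c : U → U → ℕ} {a : U → ℕ}
    (h : (⊤ : SimpleGraph U).IsWindowLabelling d t c a) (ht : 0 < t) :
    ∃ c a, (⊤ : SimpleGraph (Bool × U)).IsWindowLabelling (2 * d + 1) (t + 2 * d + 1) c a := by
  classical
  -- With `a = a u`, the three blocks `[a, a + d)`, `[a + d, a + 2d)`, `{a + 2d}` serve the edges at
  -- `(false, u)` inside its copy, across, and to its twin. At `(true, u)` the inner block is
  -- instead `[a + 2d + 1, a + 3d + 1)`, so its window starts at `a + d`.
  refine ⟨fun u v =>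
    if u.1 = v.1 then (if u.1 then c u.2 v.2 + 2 * d + 1 else c u.2 v.2)
    else if u.2 = v.2 then a u.2 + 2 * d else c u.2 v.2 + d,
    fun u => if u.1 then a u.2 + d else a u.2, ?_, ?_, ?_, ?_, ?_, ?_⟩
  · rintro ⟨b, u⟩ ⟨b', v⟩
    have := h.symm u v
    cases b <;> cases b' <;> simp <;> grind
  · rintro ⟨b, u⟩ ⟨b', v⟩ e
    have := h.lower u v
    cases b <;> cases b' <;> simp at e this ⊢ <;> grind
  · rintro ⟨b, u⟩ ⟨b', v⟩ e
    have := h.upper u v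
    cases b <;> cases b' <;> simp at e this ⊢ <;> grind
  · rintro ⟨b, u⟩ ⟨b', v⟩ ⟨b'', w⟩ e e' hc
    have h1 := h.lower u v
    have h2 := h.upper u v
    have h3 := h.lower u w
    have h4 := h.upper u w
    have h5 := h.inj u v w
    cases b <;> cases b' <;> cases b'' <;> simp at e e' hc h1 h2 h3 h4 h5 ⊢ <;> grind
  · rintro ⟨b, u⟩
    have := h.le u
    cases b <;> simp <;> omega
  · intro x hx
    by_cases h1 : x < t
    · obtain ⟨v, hv, hv'⟩ := h.cover x h1
      exact ⟨(false, v), by simp; omega⟩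
    · by_cases h2 : x < 2 * d + 1
      · obtain ⟨v, hv, hv'⟩ := h.cover 0 ht
        exact ⟨(false, v), by simp; omega⟩
      · obtain ⟨v, hv, hv'⟩ := h.cover (x - (2 * d + 1)) (by omega)
        exact ⟨(true, v), by simp; omega⟩

/-- Blowing up each vertex of a complete graph into `n` independent ones. -/
theorem blowup {U : Type*} {d t n : ℕ} {c : U → U → ℕ} {a : U → ℕ}
    (h : (⊤ : SimpleGraph U).IsWindowLabelling d t c a) (hn : 1 ≤ n) (ht : 0 < t) :
    ((⊤ : SimpleGraph U).comap (Prod.fst : U × Fin n → U)).IsWindowLabelling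
      (n * d) (n * t + n - 1) (fun u v => n * c u.1 v.1 + u.2.1 + v.2.1)
      (fun u => n * a u.1 + u.2.1) where
  symm u v := by
    have := h.symm u.1 v.1
    simp only [this]
    omega
  lower u v e := by
    have := Nat.mul_le_mul_left n (h.lower u.1 v.1 e)
    omega
  upper u v e := by
    have := Nat.mul_le_mul_left n (Nat.succ_le_of_lt (h.upper u.1 v.1 e))
    have := v.2.2
    simp only [mul_add, Nat.succ_eq_add_one, mul_one] at *
    omega
  inj := by
    rintro ⟨u, i⟩ ⟨v, j⟩ ⟨w, l⟩ e e' hc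
    dsimp only at hc
    -- After cancelling `i`, the base-`n` digits recover both the old label and the copy.
    have key : n * c u v + j = n * c u w + l := by omega
    have hc' : c u v = c u w := by
      have := congrArg (· / n) key
      simpa [Nat.mul_add_div hn, Nat.div_eq_of_lt j.2, Nat.div_eq_of_lt l.2] using this
    have hjl : j = l := by
      rw [hc'] at key
      ext
      omega
    exact Prod.ext (h.inj u v w e e' hc') hjl
  le u := by
    have := Nat.mul_le_mul_left n (h.le u.1)
    have := u.2.2
    simp only [mul_add] at *
    omega
  cover x hx := by
    by_cases hxt : x < n * t
    · obtain ⟨v, h1, h2⟩ := h.cover (x / n) (Nat.div_lt_of_lt_mul hxt)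
      refine ⟨(v, ⟨0, hn⟩), ?_, ?_⟩
      · exact (Nat.mul_le_mul_left n h1).trans (Nat.mul_div_le x n)
      · have := (Nat.div_lt_iff_lt_mul hn).1 h2
        rw [mul_comm, mul_add] at this
        exact this
    · obtain ⟨v, h1, h2⟩ := h.cover (t - 1) (by omega)
      have h3 := Nat.mul_le_mul_left n (show a v + 1 ≤ t by omega)
      have h4 := Nat.mul_le_mul_left n (show t ≤ a v + d by omega)
      rw [mul_add] at h3 h4
      refine ⟨(v, ⟨n - 1, by omega⟩), ?_, ?_⟩ <;> dsimp only <;> omega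

/-- In a `d`-regular graph, the labels of a labelling shifted by one form an interval coloring. -/
theorem exists_isIntervalColoring {V : Type*} [Finite V] {G : SimpleGraph V} {d t : ℕ}
    {c : V → V → ℕ} {a : V → ℕ} (h : G.IsWindowLabelling d t c a)
    (hdeg : ∀ v, (G.neighborSet v).ncard = d) :
    ∃ α : G.edgeSet → ℕ, G.IsIntervalColoring t α := by
  -- The only use of regularity: `d` distinct labels in a window of size `d` exhaust it.
  have surj (v : V) : c v '' G.neighborSet v = Set.Ico (a v) (a v + d) := by
    refine Set.eq_of_subset_of_ncard_le ?_ ?_ (Set.finite_Ico _ _)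
    · rintro _ ⟨w, hw, rfl⟩
      exact ⟨h.lower v w hw, h.upper v w hw⟩
    · have hinj : Set.InjOn (c v) (G.neighborSet v) := fun w hw w' hw' e => h.inj v w w' hw hw' e
      rw [hinj.ncard_image, hdeg]
      simp [Set.ncard_eq_toFinset_card']
  let α : G.edgeSet → ℕ := fun e => Sym2.lift ⟨c, h.symm⟩ e.1 + 1
  have hα (v w : V) (e : G.Adj v w) : α ⟨s(v, w), e⟩ = c v w + 1 := rfl
  have hcol (v : V) : G.colorsAt α v = Set.Icc (a v + 1) (a v + d) := by
    ext x
    constructor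
    · rintro ⟨⟨e, he⟩, hv, rfl⟩
      obtain ⟨w, rfl⟩ := hv
      have := h.lower v w he
      have := h.upper v w he
      rw [hα v w he, Set.mem_Icc]
      omega
    · rintro ⟨h1, h2⟩
      obtain ⟨w, hw, hx⟩ := (surj v).ge (show x - 1 ∈ Set.Ico (a v) (a v + d) by
        rw [Set.mem_Ico]; omega)
      exact ⟨⟨s(v, w), hw⟩, Sym2.mem_mk_left _ _, by rw [hα v w hw]; omega⟩
  refine ⟨α, ?_, ?_, fun v => ⟨_, _, hcol v⟩⟩
  · ext x
    constructor
    · rintro ⟨⟨e, he⟩, rfl⟩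
      induction e using Sym2.ind with
      | _ v w =>
        have := h.upper v w he
        have := h.le v
        rw [hα v w he, Set.mem_Icc]
        omega
    · rintro ⟨h1, h2⟩
      obtain ⟨v, hv, hv'⟩ := h.cover (x - 1) (by omega)
      obtain ⟨e, -, he⟩ := (hcol v).ge (show x ∈ Set.Icc (a v + 1) (a v + d) by
        rw [Set.mem_Icc]; omega)
      exact ⟨e, he⟩
  · rintro v ⟨e, he⟩ ⟨e', he'⟩ hv hv' hne heq
    obtain ⟨w, rfl⟩ := hv
    obtain ⟨w', rfl⟩ := hv'
    rw [hα v w he, hα v w' he'] at heq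
    exact hne (by simp [h.inj v w w' he he' (by omega)])

/-- The complete graph on `p 2 ^ (q + 1)` vertices has a labelling with
`p 2 ^ (q + 2) - p - q - 2` labels. -/
theorem exists_top (p q : ℕ) (hp : 1 ≤ p) :
    ∃ (U : Type) (_ : Finite U) (t : ℕ) (c : U → U → ℕ) (a : U → ℕ),
      Nat.card U = p * 2 ^ (q + 1) ∧ 0 < t ∧ t + p + q + 2 = 2 * (p * 2 ^ (q + 1)) ∧
      (⊤ : SimpleGraph U).IsWindowLabelling (p * 2 ^ (q + 1) - 1) t c a := by
  induction q with
  | zero =>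
    obtain ⟨c, a, h⟩ := exists_top_bool_prod_fin p hp
    refine ⟨Bool × Fin p, inferInstance, 3 * p - 2, c, a, ?_, by omega, by omega, ?_⟩
    · simp [mul_comm]
    · simpa [mul_comm] using h
  | succ q ih =>
    obtain ⟨U, _, t, c, a, hU, ht, htq, h⟩ := ih
    obtain ⟨c', a', h'⟩ := h.double ht
    have hpos : 0 < p * 2 ^ (q + 1) := by positivity
    have hpow : p * 2 ^ (q + 1 + 1) = 2 * (p * 2 ^ (q + 1)) := by ring
    rw [hpow]
    generalize p * 2 ^ (q + 1) = k at *
    -- `2k` grows by `2k` but only `2k - 1` labels are added, so the deficit `p + q + 2` grows by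
    -- one.
    refine ⟨Bool × U, inferInstance, t + 2 * (k - 1) + 1, c', a', by simp [hU], by omega, by omega, ?_⟩
    rwa [show 2 * k - 1 = 2 * (k - 1) + 1 by omega]

end IsWindowLabelling

theorem IsCompleteBalancedMultipartite.nonempty_iso {V U : Type*} [Finite V] [Finite U]
    {G : SimpleGraph V} {k n : ℕ} (hG : G.IsCompleteBalancedMultipartite k n)
    (hU : Nat.card U = k) :
    Nonempty (G ≃g (⊤ : SimpleGraph U).comap (Prod.fst : U × Fin n → U)) := by
  obtain ⟨part, hcard, hadj⟩ := hG
  have f (i : Fin k) : {v // part v = i} ≃ Fin n := Finite.equivFinOfCardEq (hcard i)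
  have g : Fin k ≃ U := (Finite.equivFinOfCardEq hU).symm
  let e : V ≃ U × Fin n := (Equiv.sigmaFiberEquiv part).symm.trans
    ((Equiv.sigmaCongrRight f).trans ((Equiv.sigmaEquivProd _ _).trans
      (g.prodCongr (Equiv.refl _))))
  have he (v : V) : (e v).1 = g (part v) := rfl
  exact ⟨⟨e, by simp [he, hadj]⟩⟩

theorem IsCompleteBalancedMultipartite.ncard_neighborSet {V : Type*} [Finite V]
    {G : SimpleGraph V} {k n : ℕ} (hG : G.IsCompleteBalancedMultipartite k n) (v : V) :
    (G.neighborSet v).ncard = n * (k - 1) := by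
  have hV : Nat.card V = n * k := by
    obtain ⟨φ⟩ := hG.nonempty_iso (U := Fin k) (by simp)
    rw [Nat.card_congr φ.toEquiv, Nat.card_prod]
    simp [mul_comm]
  obtain ⟨part, hcard, hadj⟩ := hG
  have : G.neighborSet v = {w | part w = part v}ᶜ := by
    ext w
    simp [hadj, eq_comm]
  rw [this, Set.ncard_compl, hcard, hV, Nat.mul_sub_one]

end SimpleGraph

theorem corollary2p3 {V : Type*} [Finite V] (G : SimpleGraph V) (k n p q t : ℕ)
    (hn : 1 ≤ n) (hG : G.IsCompleteBalancedMultipartite k n)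
    (hp : Odd p) (hq : 1 ≤ q) (hk : k = p * 2 ^ q)
    (ht_lower : ((k : ℤ) - 1) * n ≤ t)
    (ht_upper : (t : ℤ) ≤ (2 * (k : ℤ) - p - q) * n - 1) :
    ∃ α : G.edgeSet → ℕ, G.IsIntervalColoring t α := by
  obtain ⟨q, rfl⟩ : ∃ r, q = r + 1 := ⟨q - 1, by omega⟩
  obtain ⟨U, _, T, c, a, hU, hT, hTq, h⟩ := SimpleGraph.IsWindowLabelling.exists_top p q hp.pos
  rw [← hk] at hU hTq h
  obtain ⟨φ⟩ := hG.nonempty_iso hU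
  have hk1 : 1 ≤ k := by omega
  have hlow : n * (k - 1) ≤ t := by
    zify [hk1]
    linarith
  have hupp : t ≤ n * T + n - 1 := by
    have hT' : (2 * (k : ℤ) - p - (q + 1 : ℕ)) = T + 1 := by
      push_cast
      omega
    rw [hT'] at ht_upper
    have : (t : ℤ) + 1 ≤ n * T + n := by linarith
    have : t + 1 ≤ n * T + n := by exact_mod_cast this
    omega
  obtain ⟨c', a', h'⟩ := ((h.blowup hn hT).of_iso φ).exists_of_le hlow hupp
  exact h'.exists_isIntervalColoring hG.ncard_neighborSet
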